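/- A crossed module $\partial\colon C\to G$ consists of groups $C,G$, a homomorphism $\partial$ and an action $(g,c)\mapsto{}^gc$ of $G$ on $C$ by automorphisms such that $\partial({}^gc)=g\,\partial(c)\,g^{-1}$ and $aba^{-1}={}^{\partial a}b$ for all $g\in G$ and $a,b,c\in C$. It is free on a map $\varphi\colon Y\to C$ if for every crossed module $\delta\colon D\to H$, every homomorphism $\alpha\colon G\to H$ and every map $b\colon Y\to D$ with $\alpha\circ\partial\circ\varphi=\delta\circ b$ there is exactly one homomorphism $\beta\colon C\to D$ with $\beta\circ\varphi=b$ such that $(\beta,\alpha)$ is a morphism of crossed modules. A crossed $G$-module $E$ is generated by a family $\varphi\colon Y\to E$ subject to relations $a_k=b_k$ between elements of the free crossed $G$-module $C$ on formal generators $\psi\colon Y\to C$ (with the boundaries of the $\varphi(i)$) if the canonical morphism $C\to E$ over $\mathrm{id}_G$ is surjective and its kernel is the smallest $G$-stable normal subgroup of $C$ containing all $a_kb_k^{-1}$. Let $n\ge 3$, let $B_n$ be Artin's braid group, generated by $\sigma_1,\dots,\sigma_{n-1}$ subject to $\sigma_i\sigma_j=\sigma_j\sigma_i$ for $|i-j|\ge2$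 and $\sigma_j\sigma_{j+1}\sigma_j=\sigma_{j+1}\sigma_j\sigma_{j+1}$ for $1\le j\le n-2$, and let $\partial\colon C_n\to B_n$ be the free crossed $B_n$-module on a single generator $[r]\in C_n$ with $\partial[r]=\sigma_1$. **Theorem 5.1.** 1. The kernel of $\partial$ is a central subgroup of $C_n$, the map $\partial$ is surjective, and $\ker\partial$ is canonically isomorphic to $\mathrm H_2(B_n)=\mathrm H_2(B_n;\mathbb Z)$: there is an isomorphism $\mathrm H_2(B_n)\to\ker\partial$ which, for every set-theoretic section $s$ of $\partial$, sends the class of an inhomogeneous $2$-cycle $\sum_k m_k\,(g_k,h_k)$ to $\prod_k\bigl(s(g_k)s(h_k)s(g_kh_k)^{-1}\bigr)^{m_k}$. 2. If $n=3$, then $\mathrm H_2(B_n)=0$, and, as a crossed module over itself (via the identity map and conjugation), $B_3$ is generated by $\sigma_1$ without any relations. 3. If $n\ge4$, then $\mathrm H_2(B_n)$ is cyclic of order $2$, and the corresponding subgroup $\ker\partial$ of $C_n$ is generated by ${}^{\sigma_3}[r]\cdot[r]^{-1}$. Consequently, as a crossed module over itself, $B_n$ is generated by $\sigma_1$ subject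 to the single relation ${}^{\sigma_3}\sigma_1=\sigma_1$. -/

import Mathlib

universe u v w y

/-- A crossed module `∂ : C → G`: a homomorphism `bd` together with an action of `G` on the group
`C` by automorphisms, such that `∂ (ᵍc) = g (∂ c) g⁻¹` and the Peiffer identities
`a b a⁻¹ = ^{∂ a} b` hold. -/
structure CrossedModule (C : Type u) (G : Type v) [Group C] [Group G] where
  /-- the boundary homomorphism `∂` -/
  bd : C →* G
  /-- the action of `G` on `C`; `act g c` is written `ᵍc` on paper -/
  act : G →* MulAut C
  bd_act : ∀ (g : G) (c : C), bd (act g c) = g * bd c * g⁻¹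
  peiffer : ∀ a b : C, a * b * a⁻¹ = act (bd a) b

namespace CrossedModule

/-- A group as a crossed module over itself: the identity map and the conjugation action. -/
def self (G : Type v) [Group G] : CrossedModule G G where
  bd := MonoidHom.id G
  act := MulAut.conj
  bd_act _ _ := rfl
  peiffer _ _ := rfl

/-- `(β, α)` is a morphism of crossed modules from `X` to `Z`. -/
structure IsHom {C : Type*} {G : Type*} {D : Type*} {H : Type*}
    [Group C] [Group G] [Group D] [Group H]
    (X : CrossedModule C G) (Z : CrossedModule D H) (β : C →* D) (α : G →* H) : Prop where
  bd_comp : ∀ c : C, Z.bd (β c) = α (X.bd c)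
  map_act : ∀ (g : G) (c : C), β (X.act g c) = Z.act (α g) (β c)

/-- The crossed module `X`, `∂ : C → G`, is free on the map `φ : Y → C`: for every crossed module
`δ : D → H`, homomorphism `α : G → H` and map `b : Y → D` with `α ∘ ∂ ∘ φ = δ ∘ b` there is
exactly one homomorphism `β : C → D` with `β ∘ φ = b` such that `(β, α)` is a morphism of crossed
modules. -/
def IsFreeOn {C : Type u} {G : Type v} {Y : Type y} [Group C] [Group G]
    (X : CrossedModule C G) (φ : Y → C) : Prop :=
  ∀ (D H : Type (max u v y)) [Group D] [Group H] (Z : CrossedModule D H) (α : G →* H) (b : Y → D),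
    (∀ i, α (X.bd (φ i)) = Z.bd (b i)) →
      ∃! β : C →* D, (∀ i, β (φ i) = b i) ∧ IsHom X Z β α

section

variable {C : Type u} {G : Type v} [Group C] [Group G] (X : CrossedModule C G)

/-- The smallest normal subgroup of `C` that is stable under the action of `G` and contains `S`. -/
def invariantClosure (S : Set C) : Subgroup C :=
  sInf {N : Subgroup C | N.Normal ∧ (∀ g : G, ∀ c ∈ N, X.act g c ∈ N) ∧ S ⊆ N}

/-- The crossed `G`-module `E` is generated by the family `φ`, subject to the relations `a = b` for
`(a, b) ∈ R`. Here the relations are pairs of elements of the free crossed `G`-module `X` on the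
family `ψ` of formal generators, and the canonical morphism `π` of crossed `G`-modules with
`π ∘ ψ = φ` is required to induce an isomorphism from the quotient of `X` by the relations
onto `E`. -/
structure IsPresentedBy {D : Type w} [Group D] {Y : Type y} (E : CrossedModule D G) (φ : Y → D)
    (X : CrossedModule C G) (ψ : Y → C) (R : Set (C × C)) : Prop where
  isFreeOn : X.IsFreeOn ψ
  exists_hom : ∃ π : C →* D, IsHom X E π (MonoidHom.id G) ∧ (∀ i, π (ψ i) = φ i) ∧
    Function.Surjective π ∧
    π.ker = X.invariantClosure {c | ∃ p ∈ R, c = p.1 * p.2⁻¹}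

theorem commute_of_mem_ker {a : C} (ha : a ∈ X.bd.ker) (b : C) : a * b = b * a := by
  have h := X.peiffer a b
  rw [MonoidHom.mem_ker.mp ha, map_one, MulAut.one_apply] at h
  exact mul_inv_eq_iff_eq_mul.mp h

/-- The kernel of `∂` is commutative. -/
instance kerCommGroup : CommGroup X.bd.ker where
  mul_comm a b := Subtype.ext (X.commute_of_mem_ker a.2 b.1)

/-- The factor set `f(g, h) = s(g) s(h) s(gh)⁻¹` of a set-theoretic section `s` of `∂`, with values
in the kernel of `∂`. -/
def factorSet (s : G → C) (hs : ∀ g, X.bd (s g) = g) (g h : G) : X.bd.ker :=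
  ⟨s g * s h * (s (g * h))⁻¹, by simp [MonoidHom.mem_ker, hs]⟩

end

end CrossedModule

/-- The second integral homology group `H₂(G)` of a group `G`. -/
noncomputable abbrev secondHomology (G : Type) [Group G] : ModuleCat ℤ :=
  groupHomology.H2 (Rep.trivial ℤ G ℤ)

/-- The defining relators of the braid group on `n` strings. The generator `σ_{i+1}` of the usual
numbering `σ_1, …, σ_{n-1}` has index `i : Fin (n - 1)`. -/
def braidRels (n : ℕ) : Set (FreeGroup (Fin (n - 1))) :=
  {w | ∃ i j : Fin (n - 1), (i : ℕ) + 2 ≤ j ∧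
    w = .of i * .of j * (.of i)⁻¹ * (.of j)⁻¹} ∪
  {w | ∃ i j : Fin (n - 1), (i : ℕ) + 1 = j ∧
    w = .of i * .of j * .of i * (.of j)⁻¹ * (.of i)⁻¹ * (.of j)⁻¹}

/-- Artin's braid group `B_n` on `n` strings. -/
abbrev BraidGroup (n : ℕ) : Type := PresentedGroup (braidRels n)

/-- The Artin generators of `B_n`; `braidGen i` is `σ_{i+1}`. -/
def braidGen {n : ℕ} (i : Fin (n - 1)) : BraidGroup n := PresentedGroup.of i

/-! Free crossed modules exist: the free crossed `G`-module on generators `i : Y` with prescribed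
boundaries `f i : G` is the free group on the symbols `ᵍi` modulo the Peiffer identities. -/

namespace FreeCrossedModule

section

variable {G : Type v} {Y : Type y} [Group G] (f : Y → G)

/-- The boundary of the symbol `ᵍi`. -/
def genBd (p : G × Y) : G := p.1 * f p.2 * p.1⁻¹

/-- The Peiffer elements on the symbols `ᵍi`. -/
def rels : Set (FreeGroup (G × Y)) :=
  {w | ∃ p q : G × Y,
    w = .of p * .of q * (.of p)⁻¹ * (.of (genBd f p * q.1, q.2))⁻¹}

/-- The underlying group of the free crossed module. -/
abbrev Carrier : Type (max v y) := PresentedGroup (rels f)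

/-- The boundary homomorphism. -/
def bd : Carrier f →* G :=
  PresentedGroup.toGroup (f := genBd f) (by
    rintro w ⟨p, q, rfl⟩
    simp only [map_mul, map_inv, FreeGroup.lift_apply_of, genBd]
    group)

@[simp] theorem bd_of (p : G × Y) : bd f (PresentedGroup.of p) = genBd f p :=
  PresentedGroup.toGroup.of _

theorem rel (p q : G × Y) : (PresentedGroup.of p * PresentedGroup.of q * (PresentedGroup.of p)⁻¹ :
    Carrier f) = PresentedGroup.of (genBd f p * q.1, q.2) := by
  have h : PresentedGroup.mk (rels f)
      (.of p * .of q * (.of p)⁻¹ * (.of (genBd f p * q.1, q.2))⁻¹) = 1 :=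
    PresentedGroup.one_of_mem ⟨p, q, rfl⟩
  simp only [map_mul, map_inv] at h
  exact mul_inv_eq_one.mp h

/-- Translation of the symbols by `h`. -/
def actHom (h : G) : Carrier f →* Carrier f :=
  PresentedGroup.toGroup (f := fun p : G × Y => PresentedGroup.of (h * p.1, p.2)) (by
    rintro w ⟨p, q, rfl⟩
    simp only [map_mul, map_inv, FreeGroup.lift_apply_of]
    rw [rel, mul_inv_eq_one]
    simp [genBd, mul_assoc])

@[simp] theorem actHom_of (h : G) (p : G × Y) :
    actHom f h (PresentedGroup.of p) = PresentedGroup.of (h * p.1, p.2) :=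
  PresentedGroup.toGroup.of _

theorem actHom_one : actHom f 1 = MonoidHom.id _ := by
  ext p; simp

theorem actHom_mul (g h : G) : actHom f (g * h) = (actHom f g).comp (actHom f h) := by
  ext p; simp [mul_assoc]

/-- The action of `G`. -/
def act : G →* MulAut (Carrier f) where
  toFun g := MonoidHom.toMulEquiv (actHom f g) (actHom f g⁻¹)
    (by rw [← actHom_mul, inv_mul_cancel, actHom_one])
    (by rw [← actHom_mul, mul_inv_cancel, actHom_one])
  map_one' := by ext x; exact DFunLike.congr_fun (actHom_one f) x
  map_mul' g h := by ext x; exact DFunLike.congr_fun (actHom_mul f g h) x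

@[simp] theorem act_of (h : G) (p : G × Y) :
    act f h (PresentedGroup.of p) = PresentedGroup.of (h * p.1, p.2) :=
  actHom_of f h p

theorem bd_act (g : G) (c : Carrier f) : bd f (act f g c) = g * bd f c * g⁻¹ := by
  have h : (bd f).comp (act f g).toMonoidHom = (MulAut.conj g).toMonoidHom.comp (bd f) := by
    ext p; simp [genBd, mul_assoc]
  exact DFunLike.congr_fun h c

theorem peiffer (a b : Carrier f) : a * b * a⁻¹ = act f (bd f a) b := by
  have h : MulAut.conj = (act f).comp (bd f) := by
    ext p : 1
    apply MulEquiv.toMonoidHom_injective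
    ext q
    simpa using rel f p q
  exact DFunLike.congr_fun (DFunLike.congr_fun h a) b

end

end FreeCrossedModule

/-- The free crossed `G`-module on generators `i : Y` with boundaries `f i : G`. -/
def freeCrossedModule {G : Type v} {Y : Type y} [Group G] (f : Y → G) :
    CrossedModule (FreeCrossedModule.Carrier f) G where
  bd := FreeCrossedModule.bd f
  act := FreeCrossedModule.act f
  bd_act := FreeCrossedModule.bd_act f
  peiffer := FreeCrossedModule.peiffer f

namespace FreeCrossedModule

/-- The generators of the free crossed module. -/
def gen {G : Type v} {Y : Type y} [Group G] (f : Y → G) (i : Y) : Carrier f :=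
  PresentedGroup.of (1, i)

theorem bd_gen {G : Type v} {Y : Type y} [Group G] (f : Y → G) (i : Y) :
    (freeCrossedModule f).bd (gen f i) = f i := by
  simp [freeCrossedModule, gen, genBd]

/-- The universal property, with test objects in arbitrary universes. -/
theorem existsUnique_lift {G : Type v} {Y : Type y} [Group G] (f : Y → G)
    {D : Type*} {H : Type*} [Group D] [Group H] (Z : CrossedModule D H) (α : G →* H) (b : Y → D)
    (hb : ∀ i, α ((freeCrossedModule f).bd (gen f i)) = Z.bd (b i)) :
    ∃! β : Carrier f →* D, (∀ i, β (gen f i) = b i) ∧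
      CrossedModule.IsHom (freeCrossedModule f) Z β α := by
  simp only [bd_gen] at hb
  have key : ∀ w ∈ rels f,
      FreeGroup.lift (fun p : G × Y => Z.act (α p.1) (b p.2)) w = 1 := by
    rintro w ⟨p, q, rfl⟩
    simp only [map_mul, map_inv, FreeGroup.lift_apply_of]
    rw [mul_inv_eq_one, Z.peiffer, Z.bd_act, ← hb, ← MulAut.mul_apply, ← map_mul]
    simp [genBd]
  let β : Carrier f →* D := PresentedGroup.toGroup key
  have hβ : ∀ p : G × Y, β (PresentedGroup.of p) = Z.act (α p.1) (b p.2) :=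
    fun p => PresentedGroup.toGroup.of key
  refine ⟨β, ⟨fun i => by simp [gen, hβ], ⟨?_, ?_⟩⟩, ?_⟩
  · intro c
    have h : Z.bd.comp β = α.comp (bd f) := by
      ext p; simp [hβ, Z.bd_act, ← hb, genBd]
    exact DFunLike.congr_fun h c
  · intro g c
    have h : β.comp (act f g).toMonoidHom = (Z.act (α g)).toMonoidHom.comp β := by
      ext p; simp [hβ]
    exact DFunLike.congr_fun h c
  · rintro γ ⟨h1, h2⟩
    ext p
    have h3 := h2.map_act p.1 (gen f p.2)
    rw [h1] at h3
    have h4 : (freeCrossedModule f).act p.1 (gen f p.2) = PresentedGroup.of p := by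
      change act f p.1 (PresentedGroup.of (1, p.2)) = _
      simp
    rw [hβ, ← h3, h4]

theorem isFreeOn {G : Type v} {Y : Type y} [Group G] (f : Y → G) :
    (freeCrossedModule f).IsFreeOn (gen f) :=
  fun _ _ _ _ Z α b hb => existsUnique_lift f Z α b hb

end FreeCrossedModule

/-! The Peiffer identity makes `ker ∂` central, and `∂` is onto because the braid relations make all
Artin generators conjugate. The main tool is `IsFreeOn.hom_ext`: two homomorphisms on `C` that agree
on the generators and differ only by central elements are equal.

Upper bound. Starting from `r`, lifts of the Artin generators can be chosen one after another so
that consecutive ones satisfy the braid relation exactly. The only remaining obstruction to a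
splitting of `∂` is given by the commutators of lifts of commuting generators, so these generate the
kernel (`ker_le_of_commutator_mem`). For `n = 3` there are none. For `n ≥ 4` conjugation in `B_n`
identifies them all, and a braid that swaps `σ_1` and `σ_3` shows that their common value equals its
inverse.

Lower bound. In the Clifford algebra the roots of type `A` satisfy the braid relation, while
orthogonal ones anticommute. The units form a central extension of their quotient by the center,
hence a crossed module; freeness maps `C` to it and sends the generator of the kernel to `-1`.

Homology. Freeness maps `C` to the central extension given by the universal cocycle, with values in
`2`-chains modulo boundaries. This map shows that evaluating factor sets on cycles is injective on
`H₂`. It is surjective onto `ker ∂` because `σ_1` has infinite order in the abelianization. -/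

namespace CrossedModule

/-! ### Central extensions as crossed modules, and general properties of free crossed modules. -/

/-- A central extension, with its base acting by conjugation with preimages. -/
noncomputable def ofCentral {D : Type*} {H : Type*} [Group D] [Group H] (p : D →* H)
    (hp : Function.Surjective p) (hc : p.ker ≤ Subgroup.center D) : CrossedModule D H where
  bd := p
  act := p.liftOfSurjective hp ⟨MulAut.conj, fun d hd => by
    ext x
    simpa [mul_inv_eq_iff_eq_mul] using (Subgroup.mem_center_iff.mp (hc hd) x).symm⟩
  bd_act h c := by
    obtain ⟨d, rfl⟩ := hp h
    simp [MonoidHom.liftOfRightInverse_comp_apply]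
  peiffer a b := by simp [MonoidHom.liftOfRightInverse_comp_apply]

/-- Transport of a crossed module along isomorphisms. -/
def transport {C G D H : Type*} [Group C] [Group G] [Group D] [Group H]
    (X : CrossedModule C G) (e : C ≃* D) (f : G ≃* H) : CrossedModule D H where
  bd := f.toMonoidHom.comp (X.bd.comp e.symm.toMonoidHom)
  act := (MulAut.congr e).toMonoidHom.comp (X.act.comp f.symm.toMonoidHom)
  bd_act g c := by simp [MulAut.congr, X.bd_act]
  peiffer a b := by
    apply e.symm.injective
    simp [MulAut.congr, X.peiffer]

theorem transport_bd {C G D H : Type*} [Group C] [Group G] [Group D] [Group H]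
    (X : CrossedModule C G) (e : C ≃* D) (f : G ≃* H) (d : D) :
    (X.transport e f).bd d = f (X.bd (e.symm d)) := rfl

theorem transport_act {C G D H : Type*} [Group C] [Group G] [Group D] [Group H]
    (X : CrossedModule C G) (e : C ≃* D) (f : G ≃* H) (h : H) (d : D) :
    (X.transport e f).act h d = e (X.act (f.symm h) (e.symm d)) := rfl

theorem IsHom.comp {C G D H E K : Type*} [Group C] [Group G] [Group D] [Group H] [Group E]
    [Group K] {X : CrossedModule C G} {Z : CrossedModule D H} {W : CrossedModule E K}
    {β : C →* D} {α : G →* H} {β' : D →* E} {α' : H →* K}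
    (h' : IsHom Z W β' α') (h : IsHom X Z β α) : IsHom X W (β'.comp β) (α'.comp α) :=
  ⟨fun c => by simp [h'.bd_comp, h.bd_comp], fun g c => by simp [h'.map_act, h.map_act]⟩

theorem isHom_transport {C G D H : Type*} [Group C] [Group G] [Group D] [Group H]
    (X : CrossedModule C G) (e : C ≃* D) (f : G ≃* H) :
    IsHom X (X.transport e f) e.toMonoidHom f.toMonoidHom :=
  ⟨fun c => by simp [transport_bd], fun g c => by simp [transport_act]⟩

namespace IsFreeOn

variable {C : Type u} {G : Type v} {Y : Type y} [Group C] [Group G] {X : CrossedModule C G}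
  {φ : Y → C}

/-- Comparison of a free crossed module with the standard construction. -/
theorem exists_hom_and_surjective (hX : X.IsFreeOn φ) :
    (∃ γ : C →* FreeCrossedModule.Carrier (fun i => X.bd (φ i)),
      (∀ i, γ (φ i) = FreeCrossedModule.gen _ i) ∧
      IsHom X (freeCrossedModule fun i => X.bd (φ i)) γ (MonoidHom.id G)) ∧
    ∃ α : FreeCrossedModule.Carrier (fun i => X.bd (φ i)) →* C,
      (∀ i, α (FreeCrossedModule.gen _ i) = φ i) ∧
      IsHom (freeCrossedModule fun i => X.bd (φ i)) X α (MonoidHom.id G) ∧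
      Function.Surjective α := by
  let f : Y → G := fun i => X.bd (φ i)
  -- `IsFreeOn` only tests objects in one universe, so the groups are lifted there and the resulting
  -- maps brought back.
  let up : FreeCrossedModule.Carrier f ≃* ULift.{u} (FreeCrossedModule.Carrier f) :=
    MulEquiv.ulift.symm
  let upG : G ≃* ULift.{max u y} G := MulEquiv.ulift.symm
  let upC : C ≃* ULift.{max v y} C := MulEquiv.ulift.symm
  obtain ⟨α, ⟨hα, hα'⟩, -⟩ :=
    FreeCrossedModule.existsUnique_lift f X (MonoidHom.id G) φ
      (fun i => FreeCrossedModule.bd_gen f i)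
  obtain ⟨β, ⟨hβ, hβ'⟩, -⟩ :=
    hX _ _ ((freeCrossedModule f).transport up upG) upG.toMonoidHom
      (fun i => up (FreeCrossedModule.gen f i)) (fun i => by
        simp [FreeCrossedModule.bd_gen, f, transport_bd])
  let γ : C →* FreeCrossedModule.Carrier f := up.symm.toMonoidHom.comp β
  have hγ : ∀ i, γ (φ i) = FreeCrossedModule.gen f i := fun i => by simp [γ, hβ]
  have hγ' : IsHom X (freeCrossedModule f) γ (MonoidHom.id G) := by
    refine ⟨fun c => ?_, fun g c => ?_⟩
    · exact upG.injective (hβ'.bd_comp c)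
    · simp [γ, hβ'.map_act, transport_act]
  have key := (hX _ _ (X.transport upC upG) upG.toMonoidHom (fun i => upC (φ i))
    (fun i => by simp [transport_bd])).unique
      (y₁ := upC.toMonoidHom.comp (α.comp γ)) (y₂ := upC.toMonoidHom)
      ⟨fun i => by simp [hγ, hα], by
        simpa using (X.isHom_transport upC upG).comp (hα'.comp hγ')⟩
      ⟨fun i => rfl, X.isHom_transport upC upG⟩
  exact ⟨⟨γ, hγ, hγ'⟩, α, hα, hα', fun c =>
    ⟨γ c, upC.injective (DFunLike.congr_fun key c)⟩⟩

/-- The universal property, with test objects in arbitrary universes. -/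
theorem exists_lift (hX : X.IsFreeOn φ) {D H : Type*} [Group D] [Group H]
    (Z : CrossedModule D H) (α : G →* H) (b : Y → D) (hb : ∀ i, α (X.bd (φ i)) = Z.bd (b i)) :
    ∃ β : C →* D, (∀ i, β (φ i) = b i) ∧ IsHom X Z β α := by
  obtain ⟨⟨γ, hγ, hγ'⟩, -⟩ := hX.exists_hom_and_surjective
  obtain ⟨β, ⟨hβ, hβ'⟩, -⟩ := FreeCrossedModule.existsUnique_lift _ Z α b
    (fun i => by rw [FreeCrossedModule.bd_gen]; exact hb i)
  exact ⟨β.comp γ, fun i => by simp [hγ, hβ], by simpa using hβ'.comp hγ'⟩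

/-- A free crossed module is generated, as a group, by the translates of its generators. -/
theorem closure_eq_top (hX : X.IsFreeOn φ) :
    Subgroup.closure {c | ∃ g i, X.act g (φ i) = c} = ⊤ := by
  obtain ⟨-, α, hα, hα', hs⟩ := hX.exists_hom_and_surjective
  rw [eq_top_iff, ← MonoidHom.range_eq_top.mpr hs, MonoidHom.range_eq_map,
    ← PresentedGroup.closure_range_of, MonoidHom.map_closure]
  refine Subgroup.closure_mono ?_
  rintro _ ⟨_, ⟨p, rfl⟩, rfl⟩
  refine ⟨p.1, p.2, ?_⟩
  have h := hα'.map_act p.1 (FreeCrossedModule.gen _ p.2)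
  rw [hα] at h
  refine h.symm.trans (congrArg α ?_)
  exact (FreeCrossedModule.act_of _ p.1 (1, p.2)).trans (by simp)

theorem range_bd (hX : X.IsFreeOn φ) :
    X.bd.range = Subgroup.normalClosure (Set.range fun i => X.bd (φ i)) := by
  apply le_antisymm
  · rw [MonoidHom.range_eq_map, ← hX.closure_eq_top, MonoidHom.map_closure, Subgroup.closure_le]
    rintro _ ⟨_, ⟨g, i, rfl⟩, rfl⟩
    rw [X.bd_act]
    exact Subgroup.normalClosure_normal.conj_mem _
      (Subgroup.subset_normalClosure (Set.mem_range_self i)) g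
  · have : X.bd.range.Normal := ⟨by
      rintro _ ⟨c, rfl⟩ g
      exact ⟨X.act g c, X.bd_act g c⟩⟩
    refine Subgroup.normalClosure_le_normal ?_
    rintro _ ⟨i, rfl⟩
    exact ⟨φ i, rfl⟩

/-- Homomorphisms from a free crossed module with surjective boundary that differ by central
elements agree if they agree on the generators. -/
theorem hom_ext (hX : X.IsFreeOn φ) (hs : Function.Surjective X.bd) {D : Type*} [Group D]
    {p q : C →* D} (hφ : ∀ i, p (φ i) = q (φ i))
    (hpq : ∀ c, p c * (q c)⁻¹ ∈ Subgroup.center D) : p = q := by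
  refine MonoidHom.eq_of_eqOn_dense hX.closure_eq_top ?_
  rintro _ ⟨g, i, rfl⟩
  -- For `g = ∂c` the translate of `φ i` is its conjugate by `c`, and conjugation does not see the
  -- central factor by which `p c` and `q c` differ.
  obtain ⟨c, rfl⟩ := hs g
  have h := Subgroup.mem_center_iff.mp (hpq c) (q c * q (φ i) * (q c)⁻¹)
  rw [← X.peiffer]
  simp only [map_mul, map_inv, hφ]
  calc p c * q (φ i) * (p c)⁻¹
      = (p c * (q c)⁻¹) * (q c * q (φ i) * (q c)⁻¹) * (p c * (q c)⁻¹)⁻¹ := by group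
    _ = q c * q (φ i) * (q c)⁻¹ := by rw [← h, mul_inv_cancel_right]

end IsFreeOn

theorem ker_le_center {C : Type u} {G : Type v} [Group C] [Group G] (X : CrossedModule C G) :
    X.bd.ker ≤ Subgroup.center C :=
  fun _ ha => Subgroup.mem_center_iff.mpr fun b => (X.commute_of_mem_ker ha b).symm

end CrossedModule

/-! ### Commutators and braid relations among lifts along the boundary. -/

/-- The first of two braiding elements is conjugate to the second under their product. -/
theorem conj_braid_eq {G : Type*} [Group G] {a b : G} (h : a * b * a = b * a * b) :
    (a * b) * a * (a * b)⁻¹ = b := by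
  rw [h]; group

namespace CrossedModule

section

open scoped commutatorElement

variable {C : Type u} {G : Type v} [Group C] [Group G] (X : CrossedModule C G)

theorem mul_inv_mem_ker {a b : C} (h : X.bd a = X.bd b) : a * b⁻¹ ∈ X.bd.ker := by
  simp [MonoidHom.mem_ker, h]

/-- Commutators only depend on boundaries. -/
theorem commutator_congr {a a' b b' : C} (ha : X.bd a = X.bd a') (hb : X.bd b = X.bd b') :
    ⁅a, b⁆ = ⁅a', b'⁆ := by
  have h1 := X.commute_of_mem_ker (X.mul_inv_mem_ker ha)
  have h2 := X.commute_of_mem_ker (X.mul_inv_mem_ker hb)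
  obtain ⟨y, hy⟩ : ∃ y, y = a * a'⁻¹ := ⟨_, rfl⟩
  obtain ⟨z, hz⟩ : ∃ z, z = b * b'⁻¹ := ⟨_, rfl⟩
  obtain rfl : a = y * a' := by simp [hy]
  obtain rfl : b = z * b' := by simp [hz]
  rw [← hy] at h1
  rw [← hz] at h2
  simp only [commutatorElement_def, mul_inv_rev]
  calc y * a' * (z * b') * (a'⁻¹ * y⁻¹) * (b'⁻¹ * z⁻¹)
      = y * (a' * z * b' * a'⁻¹) * y⁻¹ * b'⁻¹ * z⁻¹ := by group
    _ = a' * z * b' * a'⁻¹ * b'⁻¹ * z⁻¹ := by rw [h1]; group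
    _ = (z * a') * b' * a'⁻¹ * b'⁻¹ * z⁻¹ := by rw [h2 a']
    _ = z * (a' * b' * a'⁻¹ * b'⁻¹) * z⁻¹ := by group
    _ = _ := by rw [h2]; group

theorem commutator_mem_ker {a b : C} (h : Commute (X.bd a) (X.bd b)) : ⁅a, b⁆ ∈ X.bd.ker := by
  rw [MonoidHom.mem_ker, map_commutatorElement, commutatorElement_eq_one_iff_commute]
  exact h

/-- Commutators of lifts of commuting elements are invariant under simultaneous conjugation
of these elements. -/
theorem commutator_eq_of_conj (hs : Function.Surjective X.bd) {a a' b b' : C} (g : G)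
    (h : Commute (X.bd a) (X.bd b)) (ha : g * X.bd a * g⁻¹ = X.bd a')
    (hb : g * X.bd b * g⁻¹ = X.bd b') : ⁅a, b⁆ = ⁅a', b'⁆ := by
  -- Conjugating by a lift `c` of `g` does not change the commutator, which lies in the kernel and
  -- is thus central.
  obtain ⟨c, rfl⟩ := hs g
  rw [X.commutator_congr (a := a') (a' := c * a * c⁻¹) (b := b') (b' := c * b * c⁻¹)
    (by simpa using ha.symm) (by simpa using hb.symm), ← conjugate_commutatorElement,
    ← X.commute_of_mem_ker (X.commutator_mem_ker h), mul_inv_cancel_right]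

/-- Lifts of a braiding pair can be adjusted to a braiding pair. -/
theorem exists_braid_lift (hs : Function.Surjective X.bd) {g h : G} (hgh : g * h * g = h * g * h)
    {x : C} (hx : X.bd x = g) : ∃ y, X.bd y = h ∧ x * y * x = y * x * y := by
  obtain ⟨y, rfl⟩ := hs h
  subst hx
  obtain ⟨k, hk⟩ : ∃ k, k = (x * y * x) * (y * x * y)⁻¹ := ⟨_, rfl⟩
  have hkm : k ∈ X.bd.ker := by
    rw [hk]
    exact X.mul_inv_mem_ker (by simpa using hgh)
  have hc := X.commute_of_mem_ker hkm
  -- The central defect `k` is absorbed because the second element occurs once on the left of the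
  -- braid relation and twice on the right.
  refine ⟨k * y, by simp [MonoidHom.mem_ker.mp hkm], ?_⟩
  have h1 : x * y * x = k * (y * x * y) := by rw [hk]; group
  calc x * (k * y) * x = (x * k) * y * x := by group
    _ = k * (x * y * x) := by rw [← hc]; group
    _ = k * k * (y * x) * y := by rw [h1]; group
    _ = k * (y * x * k) * y := by rw [← hc (y * x)]; group
    _ = _ := by group

/-- Lifts of a sequence of successively braiding elements that braid successively. -/
theorem exists_braid_lifts (hs : Function.Surjective X.bd) {g : ℕ → G}
    (hg : ∀ i, g i * g (i + 1) * g i = g (i + 1) * g i * g (i + 1)) {x : C} (hx : X.bd x = g 0) :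
    ∃ ρ : ℕ → C, ρ 0 = x ∧ (∀ i, X.bd (ρ i) = g i) ∧
      ∀ i, ρ i * ρ (i + 1) * ρ i = ρ (i + 1) * ρ i * ρ (i + 1) := by
  choose! f hf hf' using fun i y => X.exists_braid_lift hs (hg i) (x := y)
  let ρ : ℕ → C := fun i => Nat.rec x (fun j y => f j y) i
  have hρ : ∀ i, X.bd (ρ i) = g i := by
    intro i
    induction i with
    | zero => exact hx
    | succ i ih => exact hf i _ ih
  exact ⟨ρ, rfl, hρ, fun i => hf' i _ (hρ i)⟩

end

end CrossedModule

/-! ### Generators and relations of the braid group. -/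

/-- The Artin generators, continued to a sequence that is constant from `n - 2` on. -/
def braidSeq {n : ℕ} (hn : 3 ≤ n) (i : ℕ) : BraidGroup n :=
  braidGen ⟨min i (n - 2), by omega⟩

theorem braidSeq_eq {n : ℕ} (hn : 3 ≤ n) (i : Fin (n - 1)) : braidSeq hn i = braidGen i :=
  congrArg braidGen (Fin.ext (by have := i.2; simp; omega))

theorem braidGen_comm {n : ℕ} (i j : Fin (n - 1)) (h : (i : ℕ) + 2 ≤ j) :
    Commute (braidGen i) (braidGen j) := by
  have h : PresentedGroup.mk (braidRels n) _ = 1 :=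
    PresentedGroup.one_of_mem (Or.inl ⟨i, j, h, rfl⟩)
  simp only [map_mul, map_inv, mul_inv_eq_iff_eq_mul] at h
  exact h

theorem braidGen_braid {n : ℕ} (i j : Fin (n - 1)) (h : (i : ℕ) + 1 = j) :
    braidGen i * braidGen j * braidGen i = braidGen j * braidGen i * braidGen j := by
  have h : PresentedGroup.mk (braidRels n) _ = 1 :=
    PresentedGroup.one_of_mem (Or.inr ⟨i, j, h, rfl⟩)
  simp only [map_mul, map_inv, mul_inv_eq_iff_eq_mul] at h
  exact h

theorem braidSeq_braid {n : ℕ} (hn : 3 ≤ n) (i : ℕ) :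
    braidSeq hn i * braidSeq hn (i + 1) * braidSeq hn i =
      braidSeq hn (i + 1) * braidSeq hn i * braidSeq hn (i + 1) := by
  by_cases h : i < n - 2
  · exact braidGen_braid _ _ (by simp; omega)
  -- Beyond the last generator the sequence is constant, so the relation is trivial.
  · have : braidSeq hn i = braidSeq hn (i + 1) :=
      congrArg braidGen (Fin.ext (by simp; omega))
    rw [this]

theorem braidSeq_comm {n : ℕ} (hn : 3 ≤ n) {i j : ℕ} (hij : i + 2 ≤ j) (hj : j < n - 1) :
    Commute (braidSeq hn i) (braidSeq hn j) :=
  braidGen_comm _ _ (by simp; omega)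

/-- Elements that satisfy the braid relations define a homomorphism on the braid group. -/
theorem exists_braidGroup_hom {n : ℕ} {D : Type*} [Group D] (f : Fin (n - 1) → D)
    (hc : ∀ i j : Fin (n - 1), (i : ℕ) + 2 ≤ j → Commute (f i) (f j))
    (hb : ∀ i j : Fin (n - 1), (i : ℕ) + 1 = j → f i * f j * f i = f j * f i * f j) :
    ∃ α : BraidGroup n →* D, ∀ i, α (braidGen i) = f i := by
  refine ⟨PresentedGroup.toGroup (f := f) ?_, fun i => PresentedGroup.toGroup.of _⟩
  rintro w (⟨i, j, h, rfl⟩ | ⟨i, j, h, rfl⟩)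
  · simp [(hc i j h).eq]
  · simp [hb i j h]

theorem normalClosure_braidGen {n : ℕ} (hn : 3 ≤ n) {h0 : 0 < n - 1} :
    Subgroup.normalClosure {(braidGen ⟨0, h0⟩ : BraidGroup n)} = ⊤ := by
  have key : ∀ i, braidSeq hn i ∈
      Subgroup.normalClosure {(braidGen ⟨0, h0⟩ : BraidGroup n)} := by
    intro i
    induction i with
    | zero => exact Subgroup.subset_normalClosure (by simp [braidSeq])
    | succ i ih =>
      rw [← conj_braid_eq (braidSeq_braid hn i)]
      exact Subgroup.normalClosure_normal.conj_mem _ ih _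
  rw [eq_top_iff, ← PresentedGroup.closure_range_of, Subgroup.closure_le]
  rintro _ ⟨i, rfl⟩
  have := key i
  rwa [braidSeq_eq] at this

/-! ### The upper bound for the kernel. -/

section

open scoped commutatorElement

variable {n : ℕ} {C : Type u} [Group C] {X : CrossedModule C (BraidGroup n)} {r : C}

namespace CrossedModule

theorem surjective_bd_of_braidGen (hn : 3 ≤ n) {h0 : 0 < n - 1}
    (hr : X.bd r = braidGen ⟨0, h0⟩)
    (hX : X.IsFreeOn (fun _ : Unit => r)) : Function.Surjective X.bd := by
  rw [← MonoidHom.range_eq_top, hX.range_bd, Set.range_const, hr, normalClosure_braidGen hn]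

/-- A central subgroup that contains the commutators of suitable lifts of all pairs of commuting
Artin generators contains the kernel of the boundary. -/
theorem ker_le_of_commutator_mem (hn : 3 ≤ n) {h0 : 0 < n - 1}
    (hr : X.bd r = braidGen ⟨0, h0⟩)
    (hX : X.IsFreeOn (fun _ : Unit => r)) {ρ : ℕ → C} (hρ0 : ρ 0 = r)
    (hρ : ∀ i, X.bd (ρ i) = braidSeq hn i)
    (hb : ∀ i, ρ i * ρ (i + 1) * ρ i = ρ (i + 1) * ρ i * ρ (i + 1))
    {N : Subgroup C} (hN : N ≤ X.bd.ker)
    (hc : ∀ i j, i + 2 ≤ j → j < n - 1 → ⁅ρ i, ρ j⁆ ∈ N) : X.bd.ker ≤ N := by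
  have hs := surjective_bd_of_braidGen hn hr hX
  have hnorm : N.Normal := ⟨fun a ha b => by
    rwa [← X.commute_of_mem_ker (hN ha), mul_inv_cancel_right]⟩
  -- Modulo `N` the lifts satisfy all braid relations, so `C ⧸ N → B_n` has a section `α`.
  obtain ⟨α, hα⟩ := exists_braidGroup_hom (fun i : Fin (n - 1) => (ρ i : C ⧸ N))
    (fun i j hij => by
      rw [← commutatorElement_eq_one_iff_commute]
      exact (QuotientGroup.eq_one_iff _).mpr (hc i j hij j.2))
    (fun i j hij => by
      rw [← hij]
      exact congrArg (QuotientGroup.mk' N) (hb i))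
  let p : C ⧸ N →* BraidGroup n := QuotientGroup.lift N X.bd hN
  have hp : ∀ c : C, p c = X.bd c := fun c => rfl
  have hpα : p.comp α = MonoidHom.id _ := by
    refine PresentedGroup.ext fun i => ?_
    have h : p (α (braidGen i)) = braidGen i := by rw [hα, hp, hρ, braidSeq_eq]
    exact h
  -- Both maps send `r` to its class, and they differ by elements over `1`, which are central.
  have key : QuotientGroup.mk' N = α.comp X.bd := by
    refine hX.hom_ext hs (fun _ => ?_) fun c => ?_
    · simp only [MonoidHom.comp_apply, hr, hα, hρ0, QuotientGroup.mk'_apply]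
    · obtain ⟨y, hy⟩ := QuotientGroup.mk'_surjective N
        (QuotientGroup.mk' N c * ((α.comp X.bd) c)⁻¹)
      have hy1 : X.bd y = 1 := by
        have h := congrArg p hy
        have h' : p (α (X.bd c)) = X.bd c := DFunLike.congr_fun hpα _
        rw [map_mul, map_inv, MonoidHom.comp_apply, h'] at h
        exact h.trans (mul_inv_cancel (X.bd c))
      rw [← hy, Subgroup.mem_center_iff]
      intro d
      obtain ⟨z, rfl⟩ := QuotientGroup.mk'_surjective N d
      rw [← map_mul, ← map_mul, X.commute_of_mem_ker hy1]
  intro c hc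
  have h := DFunLike.congr_fun key c
  rw [MonoidHom.comp_apply, MonoidHom.mem_ker.mp hc, map_one] at h
  exact (QuotientGroup.eq_one_iff _).mp h

/-- Over the braid group on at least four strings, the commutators of lifts of pairs of commuting
Artin generators are all equal. -/
theorem commutator_lift_eq (hn : 4 ≤ n) (hs : Function.Surjective X.bd) {ρ : ℕ → C}
    (hρ : ∀ i, X.bd (ρ i) = braidSeq (by omega : 3 ≤ n) i) (i j : ℕ) (hij : i + 2 ≤ j)
    (hj : j < n - 1) : ⁅ρ i, ρ j⁆ = ⁅ρ 0, ρ 2⁆ := by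
  have h3 : 3 ≤ n := by omega
  have h1 : ∀ i j, i + 2 ≤ j → j < n - 1 → ⁅ρ i, ρ j⁆ = ⁅ρ 0, ρ j⁆ := by
    intro i j hij hj
    induction i with
    | zero => rfl
    | succ i ih =>
      rw [← ih (by omega)]
      symm
      have c1 := braidSeq_comm h3 (i := i) (j := j) (by omega) hj
      have c2 := braidSeq_comm h3 (i := i + 1) (j := j) (by omega) hj
      -- This product conjugates generator `i` to generator `i + 1` and commutes with generator `j`.
      refine X.commutator_eq_of_conj hs (braidSeq h3 i * braidSeq h3 (i + 1)) ?_ ?_ ?_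
      · rw [hρ, hρ]; exact c1
      · rw [hρ, hρ]; exact conj_braid_eq (braidSeq_braid h3 i)
      · rw [hρ]; exact mul_inv_eq_iff_eq_mul.mpr (c1.mul_left c2).eq
  rw [h1 i j hij hj]
  obtain ⟨j, rfl⟩ : ∃ k, j = k + 2 := ⟨j - 2, by omega⟩
  clear hij
  induction j with
  | zero => rfl
  | succ j ih =>
    rw [← ih (by omega)]
    symm
    have c1 := braidSeq_comm h3 (i := 0) (j := j + 2) (by omega) (by omega)
    have c2 := braidSeq_comm h3 (i := 0) (j := j + 2 + 1) (by omega) (by omega)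
    refine X.commutator_eq_of_conj hs (braidSeq h3 (j + 2) * braidSeq h3 (j + 2 + 1)) ?_ ?_ ?_
    · rw [hρ, hρ]; exact c1
    · rw [hρ]; exact mul_inv_eq_iff_eq_mul.mpr (c1.mul_right c2).symm.eq
    · rw [hρ, hρ]; rw [show j + 1 + 2 = j + 2 + 1 by ring]
      exact conj_braid_eq (braidSeq_braid h3 (j + 2))

/-- For consecutive Artin generators `a, b, c`, the braid `b a c b` carries the first two strings as
a block past the next two; hence conjugation by it exchanges `a` and `c`. -/
theorem conj_swap {G : Type*} [Group G] {a b c : G} (hab : a * b * a = b * a * b)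
    (hbc : b * c * b = c * b * c) (hac : Commute a c) :
    (b * a * c * b) * a = c * (b * a * c * b) := by
  have hac := hac.eq
  calc (b * a * c * b) * a = b * (a * c) * b * a := by group
    _ = b * c * (a * b * a) := by rw [hac]; group
    _ = (b * c * b) * a * b := by rw [hab]; group
    _ = c * b * (c * a) * b := by rw [hbc]; group
    _ = _ := by rw [← hac]; group

theorem conj_swap' {G : Type*} [Group G] {a b c : G} (hab : a * b * a = b * a * b)
    (hbc : b * c * b = c * b * c) (hac : Commute a c) :
    (b * a * c * b) * c = a * (b * a * c * b) := by
  have h := conj_swap hbc.symm hab.symm hac.symm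
  rwa [mul_assoc b c a, ← hac.eq, ← mul_assoc] at h

/-- Swapping the two commuting generators by conjugation in `B_n` preserves the central commutator,
but swapping its arguments inverts it. -/
theorem commutator_sq_eq_one (hn : 4 ≤ n) (hs : Function.Surjective X.bd) {ρ : ℕ → C}
    (hρ : ∀ i, X.bd (ρ i) = braidSeq (by omega : 3 ≤ n) i) : ⁅ρ 0, ρ 2⁆ ^ 2 = 1 := by
  have h3 : 3 ≤ n := by omega
  have c := braidSeq_comm h3 (i := 0) (j := 2) (by omega) (by omega)
  have h := X.commutator_eq_of_conj hs (a := ρ 0) (b := ρ 2) (a' := ρ 2) (b' := ρ 0)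
    (braidSeq h3 1 * braidSeq h3 0 * braidSeq h3 2 * braidSeq h3 1)
    (by rw [hρ, hρ]; exact c)
    (by rw [hρ, hρ, mul_inv_eq_iff_eq_mul]
        exact conj_swap (braidSeq_braid h3 0) (braidSeq_braid h3 1) c)
    (by rw [hρ, hρ, mul_inv_eq_iff_eq_mul]
        exact conj_swap' (braidSeq_braid h3 0) (braidSeq_braid h3 1) c)
  rw [← commutatorElement_inv] at h
  rw [sq, ← commutatorElement_inv]
  nth_rw 2 [h]
  exact inv_mul_cancel _

/-- Two generators leave no pair with indices at distance at least two, so the trivial subgroup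
already contains all the required commutators. -/
theorem ker_eq_bot_of_three (hn : n = 3) {h0 : 0 < n - 1}
    (hr : X.bd r = braidGen ⟨0, h0⟩)
    (hX : X.IsFreeOn (fun _ : Unit => r)) : X.bd.ker = ⊥ := by
  have h3 : 3 ≤ n := hn.ge
  obtain ⟨ρ, h0, hρ, hb⟩ := X.exists_braid_lifts (surjective_bd_of_braidGen h3 hr hX)
    (braidSeq_braid h3) (x := r) hr
  rw [eq_bot_iff]
  exact ker_le_of_commutator_mem h3 hr hX h0 hρ hb bot_le fun i j h h' => by omega

theorem act_mul_inv_eq_commutator {C G : Type*} [Group C] [Group G] (X : CrossedModule C G)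
    {g : G} {a : C}
    (ha : X.bd a = g) (c : C) : X.act g c * c⁻¹ = ⁅a, c⁆ := by
  rw [← ha, ← X.peiffer, commutatorElement_def]

theorem ker_eq_zpowers (hn : 4 ≤ n) {h0 : 0 < n - 1} (h2 : 2 < n - 1)
    (hr : X.bd r = braidGen ⟨0, h0⟩)
    (hX : X.IsFreeOn (fun _ : Unit => r)) :
    X.bd.ker = Subgroup.zpowers (X.act (braidGen ⟨2, h2⟩) r * r⁻¹) ∧
      (X.act (braidGen ⟨2, h2⟩) r * r⁻¹) ^ 2 = 1 := by
  have h3 : 3 ≤ n := by omega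
  have hs := surjective_bd_of_braidGen h3 hr hX
  obtain ⟨ρ, h0, hρ, hb⟩ := X.exists_braid_lifts hs (braidSeq_braid h3) (x := r) hr
  have hk : X.act (braidGen ⟨2, h2⟩) r * r⁻¹ = ⁅ρ 0, ρ 2⁆⁻¹ := by
    rw [X.act_mul_inv_eq_commutator ((hρ 2).trans (braidSeq_eq h3 ⟨2, h2⟩)),
      commutatorElement_inv, h0]
  have hsq := commutator_sq_eq_one hn hs hρ
  have hle : Subgroup.zpowers ⁅ρ 0, ρ 2⁆ ≤ X.bd.ker := by
    rw [Subgroup.zpowers_le]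
    refine X.commutator_mem_ker ?_
    rw [hρ, hρ]
    exact braidSeq_comm h3 (by omega) (by omega)
  rw [hk, Subgroup.zpowers_inv, inv_pow, hsq, inv_one]
  refine ⟨le_antisymm ?_ hle, rfl⟩
  refine ker_le_of_commutator_mem h3 hr hX h0 hρ hb hle fun i j h h' => ?_
  rw [commutator_lift_eq hn hs hρ i j h h']
  exact Subgroup.mem_zpowers _

end CrossedModule

end

/-! ### The lower bound, from the Clifford algebra of the root lattice. -/

section

open scoped commutatorElement

/-- The root `e_i - e_{i+1}`. -/
def typeARoot (n : ℕ) (i : Fin (n - 1)) : Fin n → ℚ :=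
  Pi.single ⟨i, by omega⟩ 1 - Pi.single ⟨i + 1, by omega⟩ 1

/-- The standard quadratic form on `ℚⁿ`. -/
def sumSq (n : ℕ) : QuadraticForm ℚ (Fin n → ℚ) :=
  LinearMap.BilinMap.toQuadraticMap (dotProductBilin ℚ ℚ)

theorem sumSq_typeARoot {n : ℕ} (i : Fin (n - 1)) : sumSq n (typeARoot n i) = 2 := by
  simp [sumSq, typeARoot, dotProductBilin]
  norm_num

theorem polar_typeARoot_of_far {n : ℕ} (i j : Fin (n - 1)) (h : (i : ℕ) + 2 ≤ j) :
    QuadraticMap.polar (sumSq n) (typeARoot n i) (typeARoot n j) = 0 := by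
  have h1 : (i : ℕ) ≠ j := by omega
  have h2 : (i : ℕ) + 1 ≠ j := by omega
  have h3 : (i : ℕ) ≠ j + 1 := by omega
  simp [sumSq, typeARoot, dotProductBilin, h1, h2, h3, h1.symm, h2.symm, h3.symm,
    LinearMap.BilinMap.polar_toQuadraticMap]

theorem polar_typeARoot_of_succ {n : ℕ} (i j : Fin (n - 1)) (h : (i : ℕ) + 1 = j) :
    QuadraticMap.polar (sumSq n) (typeARoot n i) (typeARoot n j) = -2 := by
  have h1 : (i : ℕ) ≠ j := by omega
  have h3 : (i : ℕ) ≠ j + 1 := by omega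
  simp [sumSq, typeARoot, dotProductBilin, h1, h, h3, h1.symm, h3.symm,
    LinearMap.BilinMap.polar_toQuadraticMap]

/-- The root `e_i - e_{i+1}` as a unit of the Clifford algebra. -/
def cliffordRoot (n : ℕ) (i : Fin (n - 1)) : (CliffordAlgebra (sumSq n))ˣ where
  val := CliffordAlgebra.ι (sumSq n) (typeARoot n i)
  inv := (2⁻¹ : ℚ) • CliffordAlgebra.ι (sumSq n) (typeARoot n i)
  val_inv := by
    rw [mul_smul_comm, CliffordAlgebra.ι_sq_scalar, sumSq_typeARoot]
    simp [Algebra.algebraMap_eq_smul_one, smul_smul]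
  inv_val := by
    rw [smul_mul_assoc, CliffordAlgebra.ι_sq_scalar, sumSq_typeARoot]
    simp [Algebra.algebraMap_eq_smul_one, smul_smul]

theorem cliffordRoot_mul_of_far {n : ℕ} (i j : Fin (n - 1)) (h : (i : ℕ) + 2 ≤ j) :
    cliffordRoot n i * cliffordRoot n j = -1 * (cliffordRoot n j * cliffordRoot n i) := by
  ext
  have := CliffordAlgebra.ι_mul_ι_add_swap (Q := sumSq n) (typeARoot n i) (typeARoot n j)
  rw [polar_typeARoot_of_far i j h, map_zero] at this
  simpa [cliffordRoot] using eq_neg_of_add_eq_zero_left this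

/-- The result is symmetric in `a` and `b`; applied in both orders it gives the braid relation for
adjacent roots. -/
theorem mul_mul_self_of_anticomm {A : Type*} [Ring A] {a b : A}
    (ha : a * a = 2) (hab : a * b + b * a = -2) : a * b * a = -(2 * (a + b)) := by
  have : a * b * a = (a * b + b * a) * a - b * (a * a) := by noncomm_ring
  rw [this, ha, hab]
  noncomm_ring

theorem cliffordRoot_braid {n : ℕ} (i j : Fin (n - 1)) (h : (i : ℕ) + 1 = j) :
    cliffordRoot n i * cliffordRoot n j * cliffordRoot n i =
      cliffordRoot n j * cliffordRoot n i * cliffordRoot n j := by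
  ext
  have h1 := CliffordAlgebra.ι_mul_ι_add_swap (Q := sumSq n) (typeARoot n i) (typeARoot n j)
  rw [polar_typeARoot_of_succ i j h, map_neg, map_ofNat] at h1
  have h2 := fun i => CliffordAlgebra.ι_sq_scalar (sumSq n) (typeARoot n i)
  simp only [sumSq_typeARoot, map_ofNat] at h2
  simp only [cliffordRoot, Units.val_mul]
  rw [mul_mul_self_of_anticomm (h2 i) h1, mul_mul_self_of_anticomm (h2 j) (by rw [add_comm, h1]), add_comm]

theorem one_ne_neg_one_clifford (n : ℕ) : (-1 : (CliffordAlgebra (sumSq n))ˣ) ≠ 1 := by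
  intro h
  have h := congrArg Units.val h
  simp only [Units.val_neg, Units.val_one] at h
  have : IsAddTorsionFree (CliffordAlgebra (sumSq n)) := IsAddTorsionFree.of_module_rat _
  exact one_ne_zero (self_eq_neg.mp h.symm)

theorem neg_one_mem_center {A : Type*} [Ring A] : (-1 : Aˣ) ∈ Subgroup.center Aˣ :=
  Subgroup.mem_center_iff.mpr fun g => by simp

variable {n : ℕ} {C : Type u} [Group C] {X : CrossedModule C (BraidGroup n)} {r : C}

namespace CrossedModule

/-- Signs are central, so the roots define a homomorphism from `B_n` to the units modulo their
center. The induced map on `C` sends the element in question to the commutator of two anticommuting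
units, which is `-1`. -/
theorem act_mul_inv_ne_one {h0 : 0 < n - 1} (h2 : 2 < n - 1)
    (hr : X.bd r = braidGen ⟨0, h0⟩)
    (hX : X.IsFreeOn (fun _ : Unit => r)) : X.act (braidGen ⟨2, h2⟩) r * r⁻¹ ≠ 1 := by
  let U := (CliffordAlgebra (sumSq n))ˣ
  let p : U →* U ⧸ Subgroup.center U := QuotientGroup.mk' _
  let Z := ofCentral p (QuotientGroup.mk'_surjective _) (QuotientGroup.ker_mk' _).le
  obtain ⟨α, hα⟩ := exists_braidGroup_hom (fun i : Fin (n - 1) => p (cliffordRoot n i))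
    (fun i j hij => by
      have h1 : p (-1) = 1 := (QuotientGroup.eq_one_iff _).mpr neg_one_mem_center
      have h := congrArg p (cliffordRoot_mul_of_far i j hij)
      rwa [map_mul, map_mul, map_mul, h1, one_mul] at h)
    (fun i j hij => by simpa using congrArg p (cliffordRoot_braid i j hij))
  obtain ⟨β, hβ, hβ'⟩ := hX.exists_lift Z α (fun _ => cliffordRoot n ⟨0, h0⟩)
    (fun _ => by rw [hr, hα]; rfl)
  intro h
  have h := congrArg β h
  have hZ : Z.bd (cliffordRoot n ⟨2, h2⟩) = p (cliffordRoot n ⟨2, h2⟩) := rfl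
  rw [map_one, map_mul, map_inv, hβ'.map_act, hβ (), hα, Z.act_mul_inv_eq_commutator hZ,
    commutatorElement_eq_one_iff_mul_comm,
    cliffordRoot_mul_of_far ⟨0, h0⟩ ⟨2, h2⟩ le_rfl] at h
  exact one_ne_neg_one_clifford n (mul_eq_right.mp h.symm)

theorem card_ker_eq_two (hn : 4 ≤ n) {h0 : 0 < n - 1}
    (hr : X.bd r = braidGen ⟨0, h0⟩)
    (hX : X.IsFreeOn (fun _ : Unit => r)) : Nat.card X.bd.ker = 2 := by
  obtain ⟨h1, h2⟩ := ker_eq_zpowers hn (by omega) hr hX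
  rw [h1, Nat.card_zpowers]
  exact orderOf_eq_prime h2 (act_mul_inv_ne_one _ hr hX)

end CrossedModule

end

/-! ### Central extensions from cocycles that need not be normalized. -/

section

/-- A `2`-cocycle with values in a trivial module. -/
structure TwoCocycle (G : Type*) (A : Type*) [Group G] [AddCommGroup A] where
  /-- the underlying function -/
  toFun : G → G → A
  cocycle : ∀ g h k, toFun g h + toFun (g * h) k = toFun h k + toFun g (h * k)

namespace TwoCocycle

variable {G : Type*} {A : Type*} [Group G] [AddCommGroup A] (f : TwoCocycle G A)

theorem one_left (g : G) : f.toFun 1 g = f.toFun 1 1 := by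
  simpa using (f.cocycle 1 1 g).symm

theorem one_right (g : G) : f.toFun g 1 = f.toFun 1 1 := by
  simpa using f.cocycle g 1 1

/-- The central extension defined by a `2`-cocycle. -/
@[ext]
structure Extension (f : TwoCocycle G A) where
  /-- the component in the central subgroup -/
  fst : A
  /-- the image in the quotient -/
  snd : G

namespace Extension

instance : Mul f.Extension := ⟨fun x y => ⟨x.fst + y.fst + f.toFun x.snd y.snd, x.snd * y.snd⟩⟩
-- Without normalization the identity has first component `-f(1, 1)`; this is the source of the
-- later corrections by `f(1, 1)`.
instance : One f.Extension := ⟨⟨-f.toFun 1 1, 1⟩⟩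
instance : Inv f.Extension :=
  ⟨fun x => ⟨-x.fst - f.toFun 1 1 - f.toFun x.snd⁻¹ x.snd, x.snd⁻¹⟩⟩

variable {f}

theorem mul_fst (x y : f.Extension) : (x * y).fst = x.fst + y.fst + f.toFun x.snd y.snd := rfl
theorem mul_snd (x y : f.Extension) : (x * y).snd = x.snd * y.snd := rfl
theorem one_fst : (1 : f.Extension).fst = -f.toFun 1 1 := rfl
theorem one_snd : (1 : f.Extension).snd = 1 := rfl
theorem inv_fst (x : f.Extension) :
    x⁻¹.fst = -x.fst - f.toFun 1 1 - f.toFun x.snd⁻¹ x.snd := rfl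
theorem inv_snd (x : f.Extension) : x⁻¹.snd = x.snd⁻¹ := rfl

instance : Group f.Extension :=
  Group.ofLeftAxioms
    (fun x y z => by
      ext
      · simp only [mul_fst, mul_snd]
        have := f.cocycle x.snd y.snd z.snd
        rw [← sub_eq_zero] at this ⊢
        rw [← this]
        abel
      · simp only [mul_snd, mul_assoc])
    (fun x => by
      ext
      · simp only [mul_fst, one_fst, one_snd, f.one_left]
        abel
      · simp only [mul_snd, one_snd, one_mul])
    (fun x => by
      ext
      · simp only [mul_fst, one_fst, inv_fst, inv_snd]
        abel
      · simp only [mul_snd, one_snd, inv_snd, inv_mul_cancel])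

variable (f) in
/-- The projection of the extension. -/
def proj : f.Extension →* G where
  toFun := snd
  map_one' := rfl
  map_mul' _ _ := rfl

theorem proj_surjective : Function.Surjective (proj f) := fun g => ⟨⟨0, g⟩, rfl⟩

theorem ker_proj_le : (proj f).ker ≤ Subgroup.center f.Extension := by
  rintro ⟨a, g⟩ (rfl : g = 1)
  refine Subgroup.mem_center_iff.mpr fun x => ?_
  ext
  · simp only [mul_fst, f.one_left, f.one_right]
    abel
  · simp [mul_snd]

end Extension

end TwoCocycle

end

/-! ### Second homology and the kernel of the boundary. -/

section

open groupHomology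

variable {G : Type} [Group G]

theorem mem_cycles₂_trivial_iff (x : G × G →₀ ℤ) :
    x ∈ cycles₂ (Rep.trivial ℤ G ℤ) ↔
      Finsupp.linearCombination ℤ (fun p : G × G => (Finsupp.single p.2 1 -
        Finsupp.single (p.1 * p.2) 1 + Finsupp.single p.1 1 : G →₀ ℤ)) x = 0 := by
  rw [cycles₂, LinearMap.mem_ker]
  suffices h : (d₂₁ (Rep.trivial ℤ G ℤ)).hom =
      Finsupp.linearCombination ℤ (fun p : G × G => (Finsupp.single p.2 1 -
        Finsupp.single (p.1 * p.2) 1 + Finsupp.single p.1 1 : G →₀ ℤ)) by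
    rw [h]
  refine Finsupp.lhom_ext fun p m => ?_
  refine (d₂₁_single (A := Rep.trivial ℤ G ℤ) p m).trans ?_
  simp [smul_sub, smul_add]

theorem boundaries₂_trivial :
    boundaries₂ (Rep.trivial ℤ G ℤ) = LinearMap.range
      (Finsupp.linearCombination ℤ (fun p : G × G × G => (Finsupp.single (p.2.1, p.2.2) 1 -
        Finsupp.single (p.1 * p.2.1, p.2.2) 1 + Finsupp.single (p.1, p.2.1 * p.2.2) 1 -
        Finsupp.single (p.1, p.2.1) 1 : G × G →₀ ℤ))) := by
  rw [boundaries₂]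
  congr 1
  refine Finsupp.lhom_ext fun p m => ?_
  refine (d₃₂_single (A := Rep.trivial ℤ G ℤ) p m).trans ?_
  simp [smul_sub, smul_add]

end

section

open groupHomology

section

variable {G : Type} [Group G] {A : Type*} [AddCommGroup A]

namespace TwoCocycle

/-- The extension of a cocycle to a homomorphism on chains. -/
noncomputable def chainMap (f : TwoCocycle G A) : (G × G →₀ ℤ) →ₗ[ℤ] A :=
  Finsupp.linearCombination ℤ fun p => f.toFun p.1 p.2

theorem chainMap_single (f : TwoCocycle G A) (g h : G) :
    f.chainMap (Finsupp.single (g, h) 1) = f.toFun g h := by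
  simp [chainMap]

/-- On the boundary of a basis element `(g, h, k)` the vanishing is the cocycle identity. -/
theorem chainMap_of_mem_boundaries (f : TwoCocycle G A) :
    boundaries₂ (Rep.trivial ℤ G ℤ) ≤ LinearMap.ker f.chainMap := by
  rw [boundaries₂_trivial, LinearMap.range_le_ker_iff]
  refine Finsupp.lhom_ext' fun p => LinearMap.ext_ring ?_
  simp only [LinearMap.comp_apply, Finsupp.lsingle_apply, Finsupp.linearCombination_single,
    one_smul, map_add, map_sub, chainMap_single, LinearMap.zero_apply]
  have := f.cocycle p.1 p.2.1 p.2.2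
  rw [← sub_eq_zero] at this
  rw [← neg_eq_zero, ← this]
  abel

/-- Cohomologous cocycles agree on cycles. -/
theorem chainMap_eq_of_coboundary (f f' : TwoCocycle G A) (u : G → A)
    (h : ∀ g h, f'.toFun g h = f.toFun g h + (u h - u (g * h) + u g)) {z : G × G →₀ ℤ}
    (hz : z ∈ cycles₂ (Rep.trivial ℤ G ℤ)) : f'.chainMap z = f.chainMap z := by
  rw [mem_cycles₂_trivial_iff] at hz
  have key : f'.chainMap = f.chainMap + (Finsupp.linearCombination ℤ u).comp
      (Finsupp.linearCombination ℤ (fun p : G × G => (Finsupp.single p.2 1 -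
        Finsupp.single (p.1 * p.2) 1 + Finsupp.single p.1 1 : G →₀ ℤ))) := by
    refine Finsupp.lhom_ext' fun p => LinearMap.ext_ring ?_
    simp [chainMap, h]
  rw [key, LinearMap.add_apply, LinearMap.comp_apply, hz, map_zero, add_zero]

/-- The image of a cocycle under a homomorphism of the coefficients. -/
def map {B : Type*} [AddCommGroup B] (f : TwoCocycle G A) (v : A →+ B) : TwoCocycle G B where
  toFun g h := v (f.toFun g h)
  cocycle g h k := by rw [← map_add, ← map_add, f.cocycle]

theorem chainMap_map {B : Type*} [AddCommGroup B] (f : TwoCocycle G A) (v : A →+ B)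
    (z : G × G →₀ ℤ) : (f.map v).chainMap z = v (f.chainMap z) := by
  simp [chainMap, Finsupp.linearCombination_apply, Finsupp.sum, map]

variable (G) in
/-- The universal `2`-cocycle, with values in the `2`-chains modulo boundaries. -/
noncomputable def universal : TwoCocycle G ((G × G →₀ ℤ) ⧸ boundaries₂ (Rep.trivial ℤ G ℤ)) where
  toFun g h := Submodule.Quotient.mk (Finsupp.single (g, h) 1)
  cocycle g h k := by
    rw [← Submodule.Quotient.mk_add, ← Submodule.Quotient.mk_add, eq_comm,
      Submodule.Quotient.eq, boundaries₂_trivial]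
    refine ⟨Finsupp.single (g, h, k) 1, ?_⟩
    simp only [Finsupp.linearCombination_single, one_smul]
    abel

theorem chainMap_universal (z : G × G →₀ ℤ) :
    (universal G).chainMap z = Submodule.Quotient.mk z := by
  have : (universal G).chainMap = (boundaries₂ (Rep.trivial ℤ G ℤ)).mkQ := by
    refine Finsupp.lhom_ext' fun p => LinearMap.ext_ring ?_
    exact chainMap_single _ p.1 p.2
  rw [this]
  rfl

end TwoCocycle

end

namespace CrossedModule

variable {G : Type} [Group G] {C : Type u} [Group C] (X : CrossedModule C G)

/-- The factor set of a section, as a cocycle. -/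
def factorCocycle (s : G → C) (hs : ∀ g, X.bd (s g) = g) :
    TwoCocycle G (Additive X.bd.ker) where
  toFun g h := Additive.ofMul (X.factorSet s hs g h)
  cocycle g h k := by
    rw [← ofMul_mul, ← ofMul_mul]
    congr 1
    refine Subtype.ext ?_
    have h1 := X.commute_of_mem_ker (X.factorSet s hs h k).2 (s g)
    change s g * s h * (s (g * h))⁻¹ * (s (g * h) * s k * (s (g * h * k))⁻¹) =
      (X.factorSet s hs h k).1 * (s g * s (h * k) * (s (g * (h * k)))⁻¹)
    calc _ = s g * (s h * s k * (s (h * k))⁻¹) * s (h * k) * (s (g * (h * k)))⁻¹ := by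
          rw [mul_assoc g h k]; group
      _ = s g * (X.factorSet s hs h k).1 * s (h * k) * (s (g * (h * k)))⁻¹ := rfl
      _ = _ := by rw [← h1]; group

theorem factorCocycle_chainMap (s : G → C) (hs : ∀ g, X.bd (s g) = g) (z : G × G →₀ ℤ) :
    (X.factorCocycle s hs).chainMap z =
      z.sum fun p m => m • Additive.ofMul (X.factorSet s hs p.1 p.2) := by
  rw [TwoCocycle.chainMap, Finsupp.linearCombination_apply]
  rfl

theorem factorCocycle_chainMap_eq (s s' : G → C) (hs : ∀ g, X.bd (s g) = g)
    (hs' : ∀ g, X.bd (s' g) = g) {z : G × G →₀ ℤ}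
    (hz : z ∈ cycles₂ (Rep.trivial ℤ G ℤ)) :
    (X.factorCocycle s' hs').chainMap z = (X.factorCocycle s hs).chainMap z := by
  let u : G → X.bd.ker := fun g => ⟨s' g * (s g)⁻¹, X.mul_inv_mem_ker ((hs' g).trans (hs g).symm)⟩
  have hu : ∀ g, s' g = (u g).1 * s g := fun g => by simp [u]
  refine TwoCocycle.chainMap_eq_of_coboundary _ _ (fun g => Additive.ofMul (u g)) ?_ hz
  intro g h
  change Additive.ofMul (X.factorSet s' hs' g h) = Additive.ofMul (X.factorSet s hs g h) + _
  rw [← ofMul_div, ← ofMul_mul, ← ofMul_mul]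
  congr 1
  rw [div_eq_mul_inv, mul_comm]
  refine Subtype.ext ?_
  change s' g * s' h * (s' (g * h))⁻¹ =
    (u h).1 * (u (g * h)).1⁻¹ * (u g).1 * (s g * s h * (s (g * h))⁻¹)
  have h1 := X.commute_of_mem_ker (u h).2
  have h2 := X.commute_of_mem_ker (inv_mem (u (g * h)).2)
  rw [hu g, hu h, hu (g * h), mul_inv_rev]
  calc (u g).1 * s g * ((u h).1 * s h) * ((s (g * h))⁻¹ * (u (g * h)).1⁻¹)
      = ((u g).1 * s g * (u h).1 * s h * (s (g * h))⁻¹) * (u (g * h)).1⁻¹ := by group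
    _ = (u (g * h)).1⁻¹ * (((u g).1 * s g) * (u h).1) * s h * (s (g * h))⁻¹ := by
        rw [← h2]; group
    _ = ((u (g * h)).1⁻¹ * (u h).1) * (u g).1 * (s g * s h * (s (g * h))⁻¹) := by
        rw [← h1]; group
    _ = _ := by rw [h2]

variable {X} {r : C}

/-- A free crossed module maps to every central extension. -/
theorem IsFreeOn.exists_hom_extension (hX : X.IsFreeOn (fun _ : Unit => r)) {A : Type*}
    [AddCommGroup A] (f : TwoCocycle G A) :
    ∃ β : C →* f.Extension, β r = ⟨0, X.bd r⟩ ∧ ∀ c, (β c).snd = X.bd c := by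
  obtain ⟨β, hβ, hβ'⟩ := hX.exists_lift
    (ofCentral (TwoCocycle.Extension.proj f) TwoCocycle.Extension.proj_surjective
      TwoCocycle.Extension.ker_proj_le) (MonoidHom.id G) (fun _ => ⟨0, X.bd r⟩) (fun _ => rfl)
  exact ⟨β, hβ (), hβ'.bd_comp⟩

theorem mem_boundaries_of_factorCocycle (hX : X.IsFreeOn (fun _ : Unit => r)) (s : G → C)
    (hs : ∀ g, X.bd (s g) = g) {z : G × G →₀ ℤ} (hz : z ∈ cycles₂ (Rep.trivial ℤ G ℤ))
    (h : (X.factorCocycle s hs).chainMap z = 0) : z ∈ boundaries₂ (Rep.trivial ℤ G ℤ) := by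
  obtain ⟨β, -, hβ⟩ := hX.exists_hom_extension (TwoCocycle.universal G)
  let f := TwoCocycle.universal G
  have hmul : ∀ a b, (β (a * b)).fst = (β a).fst + (β b).fst + f.toFun (X.bd a) (X.bd b) := by
    intro a b
    rw [map_mul, TwoCocycle.Extension.mul_fst, hβ, hβ]
  -- The restriction of `β` to the kernel, shifted by `f(1, 1)` so that it becomes additive.
  let v : Additive X.bd.ker →+ _ := AddMonoidHom.mk' (fun k => (β k.toMul.1).fst + f.toFun 1 1)
    (by
      intro a b
      change (β (a.toMul.1 * b.toMul.1)).fst + _ = _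
      rw [hmul, MonoidHom.mem_ker.mp a.toMul.2, MonoidHom.mem_ker.mp b.toMul.2]
      abel)
  -- Applying `v` to the factor set gives a cocycle cohomologous to the universal one, so on a cycle
  -- `z` it yields the class of `z` modulo boundaries.
  have key := TwoCocycle.chainMap_eq_of_coboundary f ((X.factorCocycle s hs).map v)
    (fun g => (β (s g)).fst) (fun g h => by
      change (β (X.factorSet s hs g h).1).fst + f.toFun 1 1 = _
      have h1 : (X.factorSet s hs g h).1 * s (g * h) = s g * s h := by simp [factorSet]
      have h2 := congrArg (fun c => (β c).fst) h1
      simp only [hmul, MonoidHom.mem_ker.mp (X.factorSet s hs g h).2, hs, f.one_left] at h2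
      rw [← sub_eq_zero] at h2 ⊢
      rw [← h2]
      abel) hz
  rw [TwoCocycle.chainMap_map, h, map_zero, TwoCocycle.chainMap_universal] at key
  exact (Submodule.Quotient.mk_eq_zero _).mp key.symm

/-- If the boundary of the generator has infinite order in the abelianization, then the kernel of
the boundary consists of values of cycles under the factor set. -/
theorem exists_cycle_of_mem_ker (hX : X.IsFreeOn (fun _ : Unit => r))
    (hsurj : Function.Surjective X.bd) (ε : G →* Multiplicative ℤ)
    (hε : ε (X.bd r) = Multiplicative.ofAdd 1) (s : G → C)
    (hs : ∀ g, X.bd (s g) = g) (k : X.bd.ker) :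
    ∃ z ∈ cycles₂ (Rep.trivial ℤ G ℤ),
      (X.factorCocycle s hs).chainMap z = Additive.ofMul k := by
  classical
  -- The section is changed to take `∂r` to `r`, so that `γ ∘ β` below fixes `r`.
  let s' : G → C := Function.update s (X.bd r) r
  have hs' : ∀ g, X.bd (s' g) = g := by
    intro g
    by_cases h : g = X.bd r
    · rw [h]; simp [s']
    · simp [s', h, hs]
  suffices h : ∃ z ∈ cycles₂ (Rep.trivial ℤ G ℤ),
      (X.factorCocycle s' hs').chainMap z = Additive.ofMul k by
    obtain ⟨z, hz, h⟩ := h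
    exact ⟨z, hz, by rw [← h, X.factorCocycle_chainMap_eq s s' hs hs' hz]⟩
  obtain ⟨β, hβr, hβ⟩ := hX.exists_hom_extension (TwoCocycle.universal G)
  let d : (G × G →₀ ℤ) →ₗ[ℤ] (G →₀ ℤ) :=
    Finsupp.linearCombination ℤ (fun p : G × G => (Finsupp.single p.2 1 -
        Finsupp.single (p.1 * p.2) 1 + Finsupp.single p.1 1 : G →₀ ℤ))
  have hd : ∀ g h, d (Finsupp.single (g, h) 1) =
      Finsupp.single h 1 - Finsupp.single (g * h) 1 + Finsupp.single g 1 := by simp [d]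
  let d' : ((G × G →₀ ℤ) ⧸ boundaries₂ (Rep.trivial ℤ G ℤ)) →ₗ[ℤ] (G →₀ ℤ) :=
    Submodule.liftQ _ d fun z hz =>
      (mem_cycles₂_trivial_iff z).mp (boundaries₂_le_cycles₂ _ hz)
  let θ : ((G × G →₀ ℤ) ⧸ boundaries₂ (Rep.trivial ℤ G ℤ)) →ₗ[ℤ] Additive X.bd.ker :=
    Submodule.liftQ _ (X.factorCocycle s' hs').chainMap
      (TwoCocycle.chainMap_of_mem_boundaries _)
  -- The differential sends `(g, h)` to `[h] - [gh] + [g]`; adding `[g]` to the differential of the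
  -- first component therefore gives a homomorphism.
  let δ : (TwoCocycle.universal G).Extension →* Multiplicative (G →₀ ℤ) :=
    MonoidHom.mk' (fun x => Multiplicative.ofAdd (d' x.fst + Finsupp.single x.snd 1)) (by
      intro x y
      have h : d' ((TwoCocycle.universal G).toFun x.snd y.snd) = _ := hd x.snd y.snd
      rw [← ofAdd_add, TwoCocycle.Extension.mul_fst, TwoCocycle.Extension.mul_snd,
        map_add d', map_add d', h]
      congr 1
      abel)
  let γ : (TwoCocycle.universal G).Extension →* C :=
    MonoidHom.mk' (fun x => (θ x.fst).toMul.1 * s' x.snd) (by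
      intro x y
      have h : θ ((TwoCocycle.universal G).toFun x.snd y.snd) =
          Additive.ofMul (X.factorSet s' hs' x.snd y.snd) := TwoCocycle.chainMap_single _ _ _
      rw [TwoCocycle.Extension.mul_fst, TwoCocycle.Extension.mul_snd, map_add θ, map_add θ, h]
      change (θ x.fst).toMul.1 * (θ y.fst).toMul.1 *
        (s' x.snd * s' y.snd * (s' (x.snd * y.snd))⁻¹) * s' (x.snd * y.snd) = _
      have h1 := X.commute_of_mem_ker (θ y.fst).toMul.2 (s' x.snd)
      calc _ = (θ x.fst).toMul.1 * ((θ y.fst).toMul.1 * s' x.snd) * s' y.snd := by group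
        _ = _ := by rw [h1]; group)
  have hγβ : γ.comp β = MonoidHom.id C := by
    refine hX.hom_ext hsurj (fun _ => ?_) fun c => X.ker_le_center ?_
    · simp [γ, hβr, s']
    · simp [γ, MonoidHom.mem_ker, hβ, hs', MonoidHom.mem_ker.mp (θ (β c).fst).toMul.2]
  -- Since `ε(∂r)` generates `ℤ`, the map `δ ∘ β` to an abelian group factors through `∂` and hence
  -- vanishes on the kernel.
  have hδβ : δ.comp β = (zpowersHom _ (δ (β r))).comp (ε.comp X.bd) := by
    refine hX.hom_ext hsurj (fun _ => ?_) fun c => ?_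
    · simp [hε]
    · rw [CommGroup.center_eq_top]
      exact Subgroup.mem_top _
  obtain ⟨x, hx⟩ := Submodule.Quotient.mk_surjective _ (β k.1).fst
  have hk : (β k.1).snd = 1 := (hβ _).trans k.2
  have h1 : d x + Finsupp.single 1 1 = 0 := by
    have h := DFunLike.congr_fun hδβ k.1
    simp only [MonoidHom.comp_apply, MonoidHom.mem_ker.mp k.2, map_one] at h
    change d' (β k.1).fst + Finsupp.single (β k.1).snd 1 = 0 at h
    rwa [← hx, hk] at h
  have h2 : (X.factorCocycle s' hs').chainMap x + Additive.ofMul (X.factorSet s' hs' 1 1) =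
      Additive.ofMul k := by
    have h : (θ (β k.1).fst).toMul.1 * s' (β k.1).snd = k.1 := DFunLike.congr_fun hγβ k.1
    rw [← hx, hk] at h
    refine Subtype.ext (Eq.trans ?_ h)
    change _ * (s' 1 * s' 1 * (s' (1 * 1))⁻¹) = _ * s' 1
    simp only [mul_one, mul_inv_cancel_right]
    rfl
  -- The differential of `x` is `-[1]`, and that of `(1, 1)` is `[1]`. The factor set at `(1, 1)` is
  -- `s'(1)`, exactly the factor missing from `k`.
  refine ⟨x + Finsupp.single (1, 1) 1, ?_, ?_⟩
  · rw [mem_cycles₂_trivial_iff]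
    refine (map_add d _ _).trans ?_
    rw [hd, ← h1]
    simp
  · rw [map_add, TwoCocycle.chainMap_single]
    exact h2

/-- The second homology group as the kernel of a free crossed module. -/
theorem exists_secondHomology_equiv (hX : X.IsFreeOn (fun _ : Unit => r))
    (hsurj : Function.Surjective X.bd) (ε : G →* Multiplicative ℤ)
    (hε : ε (X.bd r) = Multiplicative.ofAdd 1) :
    ∃ e : secondHomology G ≃+ Additive X.bd.ker,
      ∀ (s : G → C) (hs : ∀ g, X.bd (s g) = g) (z : cycles₂ (Rep.trivial ℤ G ℤ)),
        e (H2π (Rep.trivial ℤ G ℤ) z) =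
          z.1.sum fun p (m : ℤ) => m • Additive.ofMul (X.factorSet s hs p.1 p.2) := by
  have hsurj' := hsurj
  choose s hs using hsurj'
  let π : cycles₂ (Rep.trivial ℤ G ℤ) →+ secondHomology G :=
    (H2π (Rep.trivial ℤ G ℤ)).hom.toAddMonoidHom
  have hπ : Function.Surjective π := fun x => by
    induction x using H2_induction_on with
    | h z => exact ⟨z, rfl⟩
  let Θ : cycles₂ (Rep.trivial ℤ G ℤ) →+ Additive X.bd.ker :=
    ((X.factorCocycle s hs).chainMap.comp
      (cycles₂ (Rep.trivial ℤ G ℤ)).subtype).toAddMonoidHom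
  have hΘ : Function.Surjective Θ := fun k => by
    obtain ⟨z, hz, h⟩ := exists_cycle_of_mem_ker hX hsurj ε hε s hs k.toMul
    exact ⟨⟨z, hz⟩, h⟩
  -- Both maps from the cycles are surjective, so equality of their kernels gives the isomorphism.
  have hker : π.ker = Θ.ker := by
    ext z
    rw [AddMonoidHom.mem_ker, AddMonoidHom.mem_ker]
    refine (H2π_eq_zero_iff z).trans ⟨fun h => ?_, fun h => ?_⟩
    · exact TwoCocycle.chainMap_of_mem_boundaries _ h
    · exact mem_boundaries_of_factorCocycle hX s hs z.2 h
  let e : secondHomology G ≃+ Additive X.bd.ker :=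
    (QuotientAddGroup.quotientKerEquivOfSurjective π hπ).symm.trans
      ((QuotientAddGroup.quotientAddEquivOfEq hker).trans
        (QuotientAddGroup.quotientKerEquivOfSurjective Θ hΘ))
  have he : ∀ z, e (π z) = Θ z := by
    intro z
    have h : (QuotientAddGroup.quotientKerEquivOfSurjective π hπ).symm (π z) = (z : _ ⧸ π.ker) :=
      (AddEquiv.symm_apply_eq _).mpr rfl
    simp only [e, AddEquiv.trans_apply, h]
    rfl
  refine ⟨e, fun s' hs' z => ?_⟩
  refine (he z).trans ?_
  refine Eq.trans ?_ (X.factorCocycle_chainMap s' hs' z.1)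
  exact X.factorCocycle_chainMap_eq s' s hs' hs z.2

end CrossedModule

end

/-! ### Presentations of the base, and the theorem. -/

namespace CrossedModule

theorem invariantClosure_eq {C : Type u} {G : Type v} [Group C] [Group G] {X : CrossedModule C G}
    {S : Set C} {N : Subgroup C} (hN : N.Normal) (hG : ∀ g : G, ∀ c ∈ N, X.act g c ∈ N)
    (hS : S ⊆ N) (hSN : N ≤ Subgroup.closure S) : X.invariantClosure S = N :=
  le_antisymm (sInf_le ⟨hN, hG, hS⟩)
    (le_sInf fun _ hM => hSN.trans ((Subgroup.closure_le _).mpr hM.2.2))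

theorem act_mem_ker {C : Type u} {G : Type v} [Group C] [Group G] (X : CrossedModule C G) (g : G)
    {c : C} (hc : c ∈ X.bd.ker) : X.act g c ∈ X.bd.ker := by
  rw [MonoidHom.mem_ker, X.bd_act, MonoidHom.mem_ker.mp hc]
  simp

/-- A free crossed module with surjective boundary presents its base, with relations that
generate the kernel of the boundary. -/
theorem IsFreeOn.isPresentedBy_self {C : Type u} {G : Type v} {Y : Type y} [Group C] [Group G]
    {X : CrossedModule C G} {φ : Y → C} (hX : X.IsFreeOn φ) (hs : Function.Surjective X.bd)
    {R : Set (C × C)} (hR : X.bd.ker = Subgroup.closure {c | ∃ p ∈ R, c = p.1 * p.2⁻¹}) :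
    IsPresentedBy (self G) (fun i => X.bd (φ i)) X φ R where
  isFreeOn := hX
  exists_hom := by
    refine ⟨X.bd, ⟨fun c => rfl, fun g c => X.bd_act g c⟩, fun i => rfl, hs, ?_⟩
    refine (invariantClosure_eq inferInstance (fun g c hc => X.act_mem_ker g hc) ?_ hR.le).symm
    rw [hR]
    exact Subgroup.subset_closure

end CrossedModule

theorem theorem5p1 (n : ℕ) (hn : 3 ≤ n) {C : Type u} [Group C]
    (X : CrossedModule C (BraidGroup n)) (r : C)
    (hr : X.bd r = braidGen ⟨0, by omega⟩)
    (hX : X.IsFreeOn (fun _ : Unit => r)) :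
    -- the kernel of `∂` is central
    X.bd.ker ≤ Subgroup.center C ∧
    -- `∂` is surjective, and the kernel is canonically isomorphic to `H₂(B_n)`
    Function.Surjective X.bd ∧
    (∃ e : secondHomology (BraidGroup n) ≃+ Additive X.bd.ker,
      ∀ (s : BraidGroup n → C) (hs : ∀ g, X.bd (s g) = g)
        (z : groupHomology.cycles₂ (Rep.trivial ℤ (BraidGroup n) ℤ)),
        e (groupHomology.H2π (Rep.trivial ℤ (BraidGroup n) ℤ) z) =
          z.1.sum fun p (m : ℤ) => m • Additive.ofMul (X.factorSet s hs p.1 p.2)) ∧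
    -- the case of three strings
    (n = 3 →
      Subsingleton (secondHomology (BraidGroup n)) ∧
      CrossedModule.IsPresentedBy (CrossedModule.self (BraidGroup n))
        (fun _ : Unit => braidGen ⟨0, by omega⟩) X (fun _ : Unit => r) ∅) ∧
    -- the case of at least four strings
    (∀ h4 : 4 ≤ n,
      IsAddCyclic (secondHomology (BraidGroup n)) ∧
      Nat.card (secondHomology (BraidGroup n)) = 2 ∧
      X.bd.ker = Subgroup.zpowers (X.act (braidGen ⟨2, by omega⟩) r * r⁻¹) ∧
      CrossedModule.IsPresentedBy (CrossedModule.self (BraidGroup n))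
        (fun _ : Unit => braidGen ⟨0, by omega⟩) X (fun _ : Unit => r)
        {(X.act (braidGen ⟨2, by omega⟩) r, r)}) := by
  have hs := CrossedModule.surjective_bd_of_braidGen hn hr hX
  -- The exponent sum, which shows that `σ_1` has infinite order in the abelianization.
  obtain ⟨ε, hε⟩ := exists_braidGroup_hom (n := n) (fun _ => Multiplicative.ofAdd (1 : ℤ))
    (fun _ _ _ => Commute.refl _) (fun _ _ _ => rfl)
  have he := CrossedModule.exists_secondHomology_equiv hX hs ε (by rw [hr, hε])
  refine ⟨X.ker_le_center, hs, he, fun h3 => ?_, fun h4 => ?_⟩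
  · obtain ⟨e, -⟩ := he
    have hk := CrossedModule.ker_eq_bot_of_three h3 hr hX
    have : Subsingleton X.bd.ker := by rw [hk]; infer_instance
    refine ⟨(e.toEquiv.trans Additive.toMul).injective.subsingleton, ?_⟩
    rw [← hr]
    exact hX.isPresentedBy_self hs (by rw [hk]; simp)
  · obtain ⟨e, -⟩ := he
    have hk := (CrossedModule.ker_eq_zpowers h4 (by omega) hr hX).1
    have hcard : Nat.card (secondHomology (BraidGroup n)) = 2 :=
      (Nat.card_congr (e.toEquiv.trans Additive.toMul)).trans
        (CrossedModule.card_ker_eq_two h4 hr hX)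
    have : Fact (Nat.Prime 2) := ⟨Nat.prime_two⟩
    refine ⟨isAddCyclic_of_prime_card hcard, hcard, hk, ?_⟩
    rw [← hr]
    refine hX.isPresentedBy_self hs ?_
    rw [hk, Subgroup.zpowers_eq_closure]
    simp
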